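/- For a non-zero complex normed space $E$ and a bounded linear operator $T$ on $E$, let $$v(T)=\sup\{|f(Tx)| : x\in E,\ f\in E^*,\ \|x\|=\|f\|=f(x)=1\}$$ be the numerical radius of $T$, and let $$n(E)=\max\{k\ge 0 : k\|T\|\le v(T)\ \text{for all bounded linear operators } T \text{ on } E\}$$ be the numerical index of $E$. Write $B_E$ for the closed unit ball of $E$, and $\mathrm{ext}(B)$ for the set of extreme points of a convex set $B$. Let $X$ be a non-zero von Neumann algebra, i.e. a $*$-subalgebra of the bounded operators on a complex Hilbert space $H\neq 0$ which contains the identity and equals its double commutant. Let $X_*$ be its predual: the Banach space of normal functionals on $X$, i.e. the norm closure in the dual $X^*$ of the linear span of the functionals $x\mapsto\langle x\xi,\eta\rangle$ with $\xi,\eta\in H$. Then the following are equivalent: 1. $n(X)=1$; 2. $|x^*(x)|=1$ for every $x^*\in\mathrm{ext}(B_{X^*})$ and every $x\in\mathrm{ext}(B_X)$; 3. $n(X_*)=1$. -/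

import Mathlib

section NumericalIndex

variable {𝕜 E : Type*} [RCLike 𝕜] [NormedAddCommGroup E] [NormedSpace 𝕜 E]

/-- The numerical radius `v(T)` of a bounded linear operator `T` on a normed space `E`. -/
noncomputable def numericalRadius (T : E →L[𝕜] E) : ℝ :=
  sSup {r : ℝ | ∃ (x : E) (f : StrongDual 𝕜 E),
    ‖x‖ = 1 ∧ ‖f‖ = 1 ∧ f x = 1 ∧ r = ‖f (T x)‖}

variable (𝕜 E) in
/-- The numerical index `n(E)`: the largest `k ≥ 0` with `k ‖T‖ ≤ v(T)` for all bounded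
operators `T` on `E`. For `E ≠ 0` the set below is closed, contains `0` and is bounded by `1`, so
its supremum is its maximum. -/
noncomputable def numericalIndex : ℝ :=
  sSup {k : ℝ | 0 ≤ k ∧ ∀ T : E →L[𝕜] E, k * ‖T‖ ≤ numericalRadius T}

end NumericalIndex

namespace VonNeumannAlgebra

variable {H : Type*} [NormedAddCommGroup H] [InnerProductSpace ℂ H] [CompleteSpace H]

/-- The vector functional `x ↦ ⟪η, x ξ⟫` on the von Neumann algebra `X` (Mathlib's inner product is
linear in the second variable). -/
noncomputable def vectorFunctional (X : VonNeumannAlgebra H) (ξ η : H) :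
    StrongDual ℂ X.toStarSubalgebra :=
  ((innerSL ℂ η).comp (ContinuousLinearMap.apply ℂ H ξ)).comp
    X.toStarSubalgebra.toSubalgebra.toSubmodule.subtypeL

theorem vectorFunctional_apply (X : VonNeumannAlgebra H) (ξ η : H) (x : X.toStarSubalgebra) :
    X.vectorFunctional ξ η x = inner ℂ η ((x : H →L[ℂ] H) ξ) := rfl

/-- The norm closure in the dual space `X^*` of the space of functionals on `X` that are continuous
for the weak operator topology, which is the linear span of the vector functionals. This is the set
of normal (i.e. ultraweakly continuous) functionals. -/
noncomputable def normalFunctionals (X : VonNeumannAlgebra H) :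
    Submodule ℂ (StrongDual ℂ X.toStarSubalgebra) :=
  (Submodule.span ℂ
    {φ : StrongDual ℂ X.toStarSubalgebra | ∃ ξ η : H, φ = X.vectorFunctional ξ η}).topologicalClosure

/-- The predual `X_*` of a von Neumann algebra `X` on `H`: the Banach space of normal functionals
on `X`, with the norm of `X^*`. -/
def Predual (X : VonNeumannAlgebra H) : Type _ := X.normalFunctionals

noncomputable instance (X : VonNeumannAlgebra H) : NormedAddCommGroup X.Predual :=
  Submodule.normedAddCommGroup X.normalFunctionals

noncomputable instance (X : VonNeumannAlgebra H) : NormedSpace ℂ X.Predual :=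
  Submodule.normedSpace X.normalFunctionals

instance (X : VonNeumannAlgebra H) : CompleteSpace X.Predual :=
  (Submodule.isClosed_topologicalClosure _).completeSpace_coe

/-- The isometric inclusion of the predual `X_*` in the dual `X^*`. -/
noncomputable def Predual.incl (X : VonNeumannAlgebra H) :
    X.Predual →ₗᵢ[ℂ] StrongDual ℂ X.toStarSubalgebra :=
  X.normalFunctionals.subtypeₗᵢ

theorem norm_vectorFunctional_le (X : VonNeumannAlgebra H) (ξ η : H) :
    ‖X.vectorFunctional ξ η‖ ≤ ‖η‖ * ‖ξ‖ := by
  refine ContinuousLinearMap.opNorm_le_bound _ (by positivity) fun x => ?_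
  rw [vectorFunctional_apply]
  calc ‖inner ℂ η ((x : H →L[ℂ] H) ξ)‖ ≤ ‖η‖ * ‖(x : H →L[ℂ] H) ξ‖ := norm_inner_le_norm _ _
    _ ≤ ‖η‖ * (‖x‖ * ‖ξ‖) := by
      gcongr; exact (x : H →L[ℂ] H).le_opNorm ξ
    _ = _ := by ring

theorem vectorFunctional_mem_normalFunctionals (X : VonNeumannAlgebra H) (ξ η : H) :
    X.vectorFunctional ξ η ∈ X.normalFunctionals :=
  Submodule.le_topologicalClosure _ (Submodule.subset_span ⟨ξ, η, rfl⟩)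

/-- The Banach space `X_*` is an isometric predual of `X`: each bounded functional `F` on it is the
evaluation at exactly one `x` in `X`, and `‖F‖ = ‖x‖`. -/
theorem existsUnique_dual_predual (X : VonNeumannAlgebra H) (F : StrongDual ℂ X.Predual) :
    ∃! x : X.toStarSubalgebra, ‖x‖ = ‖F‖ ∧ ∀ φ : X.Predual, F φ = Predual.incl X φ x := by
  let v : H → H → X.Predual := fun η ξ => ⟨X.vectorFunctional ξ η, X.vectorFunctional_mem_normalFunctionals ξ η⟩
  have hv : ∀ η ξ, Predual.incl X (v η ξ) = X.vectorFunctional ξ η := fun _ _ => rfl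
  let b : H →ₗ⋆[ℂ] H →ₗ[ℂ] ℂ := LinearMap.mk₂'ₛₗ (starRingEnd ℂ) (RingHom.id ℂ) (fun η ξ => F (v η ξ))
    (fun a a' c => by
      rw [← map_add]; congr 1; refine (Predual.incl X).injective (ContinuousLinearMap.ext fun x => ?_)
      simp [hv, vectorFunctional_apply])
    (fun r a c => by
      rw [← map_smul]
      congr 1; refine (Predual.incl X).injective (ContinuousLinearMap.ext fun x => ?_)
      simp [hv, vectorFunctional_apply, mul_comm])
    (fun a c c' => by
      rw [← map_add]; congr 1; refine (Predual.incl X).injective (ContinuousLinearMap.ext fun x => ?_)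
      simp [hv, vectorFunctional_apply])
    (fun r a c => by
      rw [RingHom.id_apply, ← map_smul]
      congr 1; refine (Predual.incl X).injective (ContinuousLinearMap.ext fun x => ?_)
      simp [hv, vectorFunctional_apply])
  have hb : ∀ η ξ, ‖b η ξ‖ ≤ ‖F‖ * ‖η‖ * ‖ξ‖ := fun η ξ => by
    calc ‖F (v η ξ)‖ ≤ ‖F‖ * ‖v η ξ‖ := F.le_opNorm _
      _ ≤ ‖F‖ * (‖η‖ * ‖ξ‖) := by
        gcongr; exact X.norm_vectorFunctional_le ξ η
      _ = _ := by ring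
  let B : H →L⋆[ℂ] H →L[ℂ] ℂ := b.mkContinuous₂ ‖F‖ hb
  let y : H →L[ℂ] H := ContinuousLinearMap.adjoint (InnerProductSpace.continuousLinearMapOfBilin B)
  have hy : ∀ η ξ, inner ℂ η (y ξ) = F (v η ξ) := fun η ξ => by
    rw [ContinuousLinearMap.adjoint_inner_right, InnerProductSpace.continuousLinearMapOfBilin_apply]
    rfl
  have hyX : y ∈ X.toStarSubalgebra := by
    change y ∈ X.carrier
    rw [← X.centralizer_centralizer']
    intro z hz
    ext ξ
    refine ext_inner_left ℂ fun η => ?_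
    change inner ℂ η (z (y ξ)) = inner ℂ η (y (z ξ))
    rw [← ContinuousLinearMap.adjoint_inner_left, hy, hy]
    congr 1
    refine (Predual.incl X).injective (ContinuousLinearMap.ext fun x => ?_)
    simp only [hv, vectorFunctional_apply]
    rw [ContinuousLinearMap.adjoint_inner_left]
    have := hz x x.2
    exact congrArg (inner ℂ η) (DFunLike.congr_fun this ξ).symm
  have key : ∀ φ : X.Predual, F φ = Predual.incl X φ ⟨y, hyX⟩ := by
    obtain ⟨G, hG, -⟩ := exists_extension_norm_eq X.normalFunctionals F
    rintro ⟨φ, hφ⟩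
    refine (hG ⟨φ, hφ⟩).symm.trans ?_
    change φ ∈ {φ | G φ = φ ⟨y, hyX⟩}
    refine (closure_minimal (s := (Submodule.span ℂ {φ : StrongDual ℂ X.toStarSubalgebra |
      ∃ ξ η : H, φ = X.vectorFunctional ξ η} : Set (StrongDual ℂ X.toStarSubalgebra)))
      ?_ (isClosed_eq G.continuous (by fun_prop))) hφ
    intro φ hφ
    induction hφ using Submodule.span_induction with
    | mem φ h =>
      obtain ⟨ξ, η, rfl⟩ := h
      exact (hG (v η ξ)).trans (hy η ξ).symm
    | zero => simp
    | add a c _ _ ha hc => simpa using congrArg₂ (· + ·) ha hc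
    | smul r a _ ha => simpa using Or.inl ha
  refine ⟨⟨y, hyX⟩, ⟨le_antisymm ?_ ?_, key⟩, ?_⟩
  · refine ContinuousLinearMap.opNorm_le_bound y (norm_nonneg F) fun ξ => ?_
    by_cases h0 : ‖y ξ‖ = 0
    · rw [h0]; positivity
    have h1 : ‖inner ℂ (y ξ) (y ξ)‖ ≤ ‖F‖ * ‖y ξ‖ * ‖ξ‖ := by rw [hy]; exact hb _ _
    rw [inner_self_eq_norm_sq_to_K] at h1
    simp only [norm_pow, Complex.coe_algebraMap, Complex.norm_real, norm_norm] at h1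
    have : 0 < ‖y ξ‖ := lt_of_le_of_ne (norm_nonneg _) (Ne.symm h0)
    nlinarith
  · refine ContinuousLinearMap.opNorm_le_bound F (norm_nonneg _) fun φ => ?_
    rw [key, mul_comm]
    exact (Predual.incl X φ).le_opNorm _
  · rintro x ⟨-, hx⟩
    ext ξ
    refine ext_inner_left ℂ fun η => ?_
    exact (hx (v η ξ)).symm.trans (hy η ξ).symm

end VonNeumannAlgebra

/-! ### Numerical index one and rotated norm equations -/

section NumericalIndexOne

variable {𝕜 E : Type*} [RCLike 𝕜] [NormedAddCommGroup E] [NormedSpace 𝕜 E]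

/-! All three conditions are tied to commutativity of `X`. If `X` or `X_*` has numerical index one,
then every operator `T` on it admits unimodular `w` with `‖1 + wT‖` arbitrarily close to `1 + ‖T‖`.
For multiplication by `x` this yields unit vectors `ξ` with `w x ξ` close to `‖x‖ ξ`, hence `‖x²‖ =
‖x‖²`. A Banach algebra with this property is commutative, by Liouville's theorem
(`mul_comm_of_sq_norm_le`). Let `X` be commutative. For `T` on `X_*`, Russo–Dye gives a unitary `u`
at which the adjoint `S` nearly attains its norm. Since `u* S(u)` is normal, its norm is its
numerical radius, so some normal functional `⟨uξ, · ξ⟩` equals 1 at `u` and is almost `‖T‖` in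
modulus at `S(u)`. Hence `n(X_*) = 1`. Moreover, extreme points of the ball are unitary, and extreme
functionals are multiplicative up to scalars, so they have modulus one at unitaries; this is
condition 2. Finally, condition 2 gives `n(X) = 1`: unitaries are extreme, Russo–Dye finds one with
`‖T u‖` close to `‖T‖`, and some extreme functional attains `‖T u‖` while having modulus one at `u`.
-/

theorem bddAbove_numericalRange (T : E →L[𝕜] E) :
    BddAbove {r : ℝ | ∃ (x : E) (f : StrongDual 𝕜 E),
      ‖x‖ = 1 ∧ ‖f‖ = 1 ∧ f x = 1 ∧ r = ‖f (T x)‖} := by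
  refine ⟨‖T‖, ?_⟩
  rintro r ⟨x, f, hx, hf, -, rfl⟩
  calc ‖f (T x)‖ ≤ ‖f‖ * (‖T‖ * ‖x‖) := (f.le_opNorm _).trans (by gcongr; exact T.le_opNorm x)
    _ = ‖T‖ := by rw [hf, hx]; ring

theorem le_numericalRadius (T : E →L[𝕜] E) {x : E} {f : StrongDual 𝕜 E} (hx : ‖x‖ = 1)
    (hf : ‖f‖ = 1) (hfx : f x = 1) : ‖f (T x)‖ ≤ numericalRadius T :=
  le_csSup (bddAbove_numericalRange T) ⟨x, f, hx, hf, hfx, rfl⟩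

theorem numericalRadius_le_norm (T : E →L[𝕜] E) : numericalRadius T ≤ ‖T‖ := by
  refine Real.sSup_le ?_ (norm_nonneg T)
  rintro r ⟨x, f, hx, hf, -, rfl⟩
  calc ‖f (T x)‖ ≤ ‖f‖ * (‖T‖ * ‖x‖) := (f.le_opNorm _).trans (by gcongr; exact T.le_opNorm x)
    _ = ‖T‖ := by rw [hf, hx]; ring

/-- The supremum defining the numerical radius is taken over a non-empty set. -/
theorem exists_numericalRange_gt [Nontrivial E] (T : E →L[𝕜] E) {r : ℝ}
    (hr : r < numericalRadius T) :
    ∃ (x : E) (f : StrongDual 𝕜 E), ‖x‖ = 1 ∧ ‖f‖ = 1 ∧ f x = 1 ∧ r < ‖f (T x)‖ := by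
  have hne : {r : ℝ | ∃ (x : E) (f : StrongDual 𝕜 E),
      ‖x‖ = 1 ∧ ‖f‖ = 1 ∧ f x = 1 ∧ r = ‖f (T x)‖}.Nonempty := by
    obtain ⟨y, hy⟩ := exists_ne (0 : E)
    have hy0 : ‖y‖ ≠ 0 := norm_ne_zero_iff.2 hy
    have hx : ‖((‖y‖⁻¹ : ℝ) : 𝕜) • y‖ = 1 := by
      rw [norm_smul, RCLike.norm_ofReal, abs_inv, abs_norm, inv_mul_cancel₀ hy0]
    obtain ⟨f, hf, hfx⟩ := exists_dual_vector 𝕜 (((‖y‖⁻¹ : ℝ) : 𝕜) • y) (by rw [hx]; norm_num)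
    exact ⟨_, _, f, hx, hf, by rw [hfx, hx]; simp, rfl⟩
  obtain ⟨s, ⟨x, f, hx, hf, hfx, rfl⟩, hs⟩ := exists_lt_of_lt_csSup hne hr
  exact ⟨x, f, hx, hf, hfx, hs⟩

theorem numericalIndex_eq_one_iff [Nontrivial E] :
    numericalIndex 𝕜 E = 1 ↔ ∀ T : E →L[𝕜] E, ‖T‖ ≤ numericalRadius T := by
  have hle : ∀ k ∈ {k : ℝ | 0 ≤ k ∧ ∀ T : E →L[𝕜] E, k * ‖T‖ ≤ numericalRadius T}, k ≤ 1 := by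
    rintro k ⟨-, hk⟩
    simpa using (hk 1).trans (numericalRadius_le_norm 1)
  constructor
  · intro h T
    refine le_of_forall_pos_le_add fun ε hε => ?_
    have hpos : 0 < ε / (‖T‖ + 1) := by positivity
    have hne : {k : ℝ | 0 ≤ k ∧ ∀ T : E →L[𝕜] E, k * ‖T‖ ≤ numericalRadius T}.Nonempty := by
      by_contra hcon
      -- The supremum of the empty set is 0 by convention, which is not 1.
      rw [numericalIndex, Set.not_nonempty_iff_eq_empty.1 hcon] at h
      simp at h
    obtain ⟨k, ⟨-, hk⟩, hk1⟩ := exists_lt_of_lt_csSup hne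
      (show 1 - ε / (‖T‖ + 1) < numericalIndex 𝕜 E by rw [h]; linarith)
    have h1 := hk T
    have h2 : ε / (‖T‖ + 1) * ‖T‖ ≤ ε := by
      rw [div_mul_eq_mul_div, div_le_iff₀ (by positivity)]
      nlinarith [norm_nonneg T]
    nlinarith [norm_nonneg T]
  · intro h
    refine le_antisymm (Real.sSup_le hle zero_le_one) ?_
    exact le_csSup ⟨1, hle⟩ ⟨zero_le_one, fun T => by simpa using h T⟩

/-- A phase `w` makes a nearly maximal value `f (T x)` nonnegative, so that it adds to `f x = 1`
without cancellation. -/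
theorem exists_norm_one_add_smul_gt [Nontrivial E] (h : numericalIndex 𝕜 E = 1)
    (T : E →L[𝕜] E) {ε : ℝ} (hε : 0 < ε) :
    ∃ w : 𝕜, ‖w‖ = 1 ∧ 1 + ‖T‖ - ε < ‖1 + w • T‖ := by
  obtain ⟨x, f, hx, hf, hfx, hr⟩ := exists_numericalRange_gt T
    (show ‖T‖ - ε < numericalRadius T by linarith [numericalIndex_eq_one_iff.1 h T])
  obtain ⟨w, hw, hwf⟩ : ∃ w : 𝕜, ‖w‖ = 1 ∧ w * f (T x) = (‖f (T x)‖ : 𝕜) := by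
    obtain ⟨c, hc, h⟩ := RCLike.exists_norm_eq_mul_self (f (T x))
    exact ⟨c, hc, h.symm⟩
  refine ⟨w, hw, ?_⟩
  have h1 : f ((1 + w • T) x) = ((1 + ‖f (T x)‖ : ℝ) : 𝕜) := by
    simp [hfx, hwf]
  have h2 : ‖f ((1 + w • T) x)‖ ≤ ‖1 + w • T‖ := by
    calc ‖f ((1 + w • T) x)‖ ≤ ‖f‖ * (‖1 + w • T‖ * ‖x‖) :=
          (f.le_opNorm _).trans (by gcongr; exact (1 + w • T).le_opNorm x)
      _ = ‖1 + w • T‖ := by rw [hf, hx]; ring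
  rw [h1, RCLike.norm_ofReal, abs_of_nonneg (by positivity)] at h2
  linarith

end NumericalIndexOne

/-! ### Approximate eigenvectors in Hilbert space -/

section Hilbert

variable {H : Type*} [NormedAddCommGroup H] [InnerProductSpace ℂ H]

/-- An operator satisfying the Daugavet-type equation up to rotation has approximate eigenvectors
for a scalar of modulus equal to its norm. -/
theorem exists_norm_smul_apply_sub_le [Nontrivial H] (x : H →L[ℂ] H)
    (hx : ∀ ε > 0, ∃ w : ℂ, ‖w‖ = 1 ∧ 1 + ‖x‖ - ε < ‖1 + w • x‖) {δ : ℝ} (hδ : 0 < δ) :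
    ∃ (w : ℂ) (ξ : H), ‖w‖ = 1 ∧ ‖ξ‖ = 1 ∧ ‖w • x ξ - (‖x‖ : ℂ) • ξ‖ ≤ δ := by
  set N := ‖x‖ with hN
  have hN0 : 0 ≤ N := norm_nonneg x
  -- The final estimate is `‖w x ξ - N ξ‖² ≤ 2N(1 + N)ε`; the `+ 1` keeps the denominator positive.
  set ε := δ ^ 2 / (2 * N * (1 + N) + 1) with hε
  have hε0 : 0 < ε := by positivity
  have hεδ : 2 * N * (1 + N) * ε ≤ δ ^ 2 := by
    rw [hε, mul_div_assoc', div_le_iff₀ (by positivity)]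
    nlinarith [sq_nonneg δ]
  -- The minimum with 1 keeps `1 + N - min ε 1` nonnegative, as required of an operator norm bound.
  obtain ⟨w, hw, hwx⟩ := hx (min ε 1) (by positivity)
  obtain ⟨ξ, hξ, hξw⟩ : ∃ ξ : H, ‖ξ‖ = 1 ∧ 1 + N - min ε 1 < ‖(1 + w • x) ξ‖ := by
    by_contra! hcon
    exact absurd (ContinuousLinearMap.opNorm_le_of_unit_norm
      (by linarith [min_le_right ε 1]) hcon) (not_le.2 hwx)
  refine ⟨w, ξ, hw, hξ, ?_⟩
  have hη : ‖w • x ξ‖ ≤ N := by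
    rw [norm_smul, hw, one_mul]
    simpa [hξ] using x.le_opNorm ξ
  have e1 : ‖ξ + w • x ξ‖ ^ 2 = 1 + 2 * RCLike.re (inner ℂ ξ (w • x ξ)) + ‖w • x ξ‖ ^ 2 := by
    rw [norm_add_sq (𝕜 := ℂ), hξ]; ring
  have e2 : ‖w • x ξ - (N : ℂ) • ξ‖ ^ 2 =
      ‖w • x ξ‖ ^ 2 - 2 * (N * RCLike.re (inner ℂ ξ (w • x ξ))) + N ^ 2 := by
    have h1 : ‖(N : ℂ) • ξ‖ = N := by simp [norm_smul, hξ, abs_of_nonneg hN0]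
    have h2 : RCLike.re (inner ℂ (w • x ξ) ((N : ℂ) • ξ)) =
        N * RCLike.re (inner ℂ ξ (w • x ξ)) := by
      rw [inner_smul_right, ← inner_conj_symm]
      generalize inner ℂ ξ (w • x ξ) = z
      simp
    rw [norm_sub_sq (𝕜 := ℂ), h1, h2]
  have hlow : (1 + N - ε) ^ 2 ≤ ‖ξ + w • x ξ‖ ^ 2 ∨ 1 + N - ε < 0 := by
    rcases le_or_gt 0 (1 + N - ε) with h | h
    · left
      have : 1 + N - ε ≤ ‖ξ + w • x ξ‖ := by
        have h3 : ‖(1 + w • x) ξ‖ = ‖ξ + w • x ξ‖ := by simp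
        rw [← h3]; linarith [min_le_left ε 1]
      gcongr
    · exact Or.inr h
  have hre : N - ε * (1 + N) ≤ RCLike.re (inner ℂ ξ (w • x ξ)) := by
    rcases hlow with h | h
    · nlinarith [norm_nonneg (w • x ξ), sq_nonneg ε]
    · have h4 : |RCLike.re (inner ℂ ξ (w • x ξ))| ≤ N :=
        (RCLike.abs_re_le_norm _).trans ((norm_inner_le_norm _ _).trans (by rwa [hξ, one_mul]))
      nlinarith [neg_le_of_abs_le h4]
  have h5 : ‖w • x ξ - (N : ℂ) • ξ‖ ^ 2 ≤ δ ^ 2 := by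
    nlinarith [norm_nonneg (w • x ξ), mul_le_mul_of_nonneg_left hre hN0]
  exact le_of_sq_le_sq h5 hδ.le

/-- If `w x ξ ≈ ‖x‖ ξ`, then applying `w x` again gives `w² x² ξ ≈ ‖x‖² ξ`. -/
theorem sq_norm_le_norm_mul_self [Nontrivial H] (x : H →L[ℂ] H)
    (hx : ∀ ε > 0, ∃ w : ℂ, ‖w‖ = 1 ∧ 1 + ‖x‖ - ε < ‖1 + w • x‖) :
    ‖x‖ ^ 2 ≤ ‖x * x‖ := by
  refine le_of_forall_pos_le_add fun ε hε => ?_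
  obtain ⟨w, ξ, hw, hξ, h⟩ := exists_norm_smul_apply_sub_le x hx
    (show 0 < ε / (2 * ‖x‖ + 1) by positivity)
  set δ := ε / (2 * ‖x‖ + 1) with hδ
  have hδε : 2 * ‖x‖ * δ ≤ ε := by
    rw [hδ, mul_div_assoc', div_le_iff₀ (by positivity)]
    nlinarith [norm_nonneg x]
  have e : ((‖x‖ : ℂ) ^ 2) • ξ = (w ^ 2) • (x * x) ξ - w • x (w • x ξ - (‖x‖ : ℂ) • ξ)
      - (‖x‖ : ℂ) • (w • x ξ - (‖x‖ : ℂ) • ξ) := by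
    rw [show (x * x) ξ = x (x ξ) from rfl]
    simp only [map_sub, map_smul, smul_sub, smul_smul]
    module
  have h1 : ‖((‖x‖ : ℂ) ^ 2) • ξ‖ = ‖x‖ ^ 2 := by
    rw [norm_smul, hξ]; simp
  have h2 : ‖(w ^ 2) • (x * x) ξ‖ ≤ ‖x * x‖ := by
    rw [norm_smul, norm_pow, hw]
    simpa [hξ] using (x * x).le_opNorm ξ
  have h3 : ‖w • x (w • x ξ - (‖x‖ : ℂ) • ξ)‖ ≤ ‖x‖ * δ := by
    rw [norm_smul, hw, one_mul]
    exact (x.le_opNorm _).trans (by gcongr)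
  have h4 : ‖(‖x‖ : ℂ) • (w • x ξ - (‖x‖ : ℂ) • ξ)‖ ≤ ‖x‖ * δ := by
    rw [norm_smul, Complex.norm_real, norm_norm]
    gcongr
  rw [← h1, e]
  calc _ ≤ _ := (norm_sub_le _ _).trans (add_le_add (norm_sub_le _ _) le_rfl)
    _ ≤ ‖x * x‖ + ‖x‖ * δ + ‖x‖ * δ := by gcongr
    _ ≤ ‖x * x‖ + ε := by linarith

end Hilbert

/-! ### Commutativity from the norms of squares -/

section BanachAlgebra

open NormedSpace Filter Topology
open scoped NNReal ENNReal

variable {A : Type*} [NormedRing A] [NormedAlgebra ℂ A]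

theorem spectralRadius_mul_le (a b : A) : spectralRadius ℂ (a * b) ≤ spectralRadius ℂ (b * a) := by
  refine iSup₂_le fun k hk => ?_
  by_cases hk0 : k = 0
  · simp [hk0]
  have : k ∈ spectrum ℂ (b * a) \ {0} := by
    rw [← spectrum.nonzero_mul_comm]
    exact ⟨hk, hk0⟩
  exact le_iSup₂ (f := fun k (_ : k ∈ spectrum ℂ (b * a)) => (‖k‖₊ : ℝ≥0∞)) k this.1

variable [CompleteSpace A]

theorem spectralRadius_eq_nnnorm_of_sq_norm_le (h : ∀ x : A, ‖x‖ ^ 2 ≤ ‖x * x‖) (a : A) :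
    spectralRadius ℂ a = ‖a‖₊ := by
  have hsq : ∀ x : A, ‖x * x‖₊ = ‖x‖₊ ^ 2 := fun x =>
    NNReal.eq (le_antisymm ((norm_mul_le x x).trans_eq (by simp [sq])) (h x))
  have hpow : ∀ n : ℕ, ‖a ^ 2 ^ n‖₊ = ‖a‖₊ ^ 2 ^ n := by
    intro n
    induction n with
    | zero => simp
    | succ n ih => rw [pow_succ, pow_mul, sq, hsq, ih, ← pow_mul]
  have hconst : Tendsto (fun _n : ℕ => (‖a‖₊ : ℝ≥0∞)) atTop _ := tendsto_const_nhds
  refine tendsto_nhds_unique ?_ hconst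
  -- Gelfand's formula along the exponents `2 ^ n`, where the sequence is constant.
  convert!
    (spectrum.pow_nnnorm_pow_one_div_tendsto_nhds_spectralRadius (a : A)).comp
      (tendsto_pow_atTop_atTop_of_one_lt one_lt_two) using 1
  refine funext fun n => ?_
  rw [Function.comp_apply, hpow, ENNReal.coe_pow, ← ENNReal.rpow_natCast, ← ENNReal.rpow_mul]
  simp

/-- A Banach algebra in which `‖x²‖ = ‖x‖²` for all `x` is commutative. -/
theorem mul_comm_of_sq_norm_le (h : ∀ x : A, ‖x‖ ^ 2 ≤ ‖x * x‖) (a b : A) : a * b = b * a := by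
  have hnorm : ∀ x y : A, ‖x * y‖ ≤ ‖y * x‖ := fun x y => by
    have := spectralRadius_mul_le x y
    rw [spectralRadius_eq_nnnorm_of_sq_norm_le h, spectralRadius_eq_nnnorm_of_sq_norm_le h] at this
    exact_mod_cast this
  let _ : NormedAlgebra ℚ A := .restrictScalars ℚ ℂ A
  have hexp : ∀ z : ℂ, exp (z • -a) * exp (z • a) = 1 := fun z => by
    rw [← exp_add_of_commute (by simp [Commute, SemiconjBy])]
    simp
  -- Since `‖x y‖ ≤ ‖y x‖`, this entire function is bounded by `‖b‖`, hence constant.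
  -- Differentiating `exp(za) b = b exp(za)` at 0 gives `a b = b a`.
  have hf : Differentiable ℂ (fun z : ℂ => exp (z • a) * b * exp (z • -a)) := by fun_prop
  have hb : Bornology.IsBounded (Set.range (fun z : ℂ => exp (z • a) * b * exp (z • -a))) := by
    refine (Metric.isBounded_closedBall (x := (0 : A)) (r := ‖b‖)).subset ?_
    rintro - ⟨z, rfl⟩
    rw [mem_closedBall_zero_iff]
    calc ‖exp (z • a) * b * exp (z • -a)‖ = ‖exp (z • a) * (b * exp (z • -a))‖ := by
          rw [mul_assoc]
      _ ≤ ‖b * exp (z • -a) * exp (z • a)‖ := hnorm _ _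
      _ = ‖b‖ := by rw [mul_assoc, hexp, mul_one]
  have key : ∀ z : ℂ, exp (z • a) * b = b * exp (z • a) := fun z => by
    have := congrArg (· * exp (z • a)) (hf.apply_eq_apply_of_bounded hb z 0)
    simp only [mul_assoc, hexp, mul_one, zero_smul, exp_zero, one_mul] at this
    exact this
  have hd : HasDerivAt (fun z : ℂ => exp (z • a)) a 0 := by
    simpa using hasDerivAt_exp_smul_const a (0 : ℂ)
  exact (hd.mul_const b).unique (by simpa only [key] using hd.const_mul b)

end BanachAlgebra

/-! ### Unitaries and the Russo–Dye theorem -/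

section RussoDye

variable {A : Type*} [CStarAlgebra A]

/-- Polar decomposition: `v = w p` with `w` unitary and `p = |v|`. The self-adjoint contraction `h =
p/2` is the mean of the unitaries `h ± i√(1 - h²)`. -/
theorem exists_unitary_add_eq_of_isUnit {v : A} (hv : IsUnit v) (hv2 : ‖v‖ ≤ 2) :
    ∃ u₁ ∈ unitary A, ∃ u₂ ∈ unitary A, v = u₁ + u₂ := by
  let _ := CStarAlgebra.spectralOrder A
  let _ := CStarAlgebra.spectralOrderedRing A
  set p := CFC.sqrt (star v * v) with hp
  have hpp : p * p = star v * v := CFC.sqrt_mul_sqrt_self _ (star_mul_self_nonneg v)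
  have hps : IsSelfAdjoint p := (CFC.sqrt_nonneg (star v * v)).isSelfAdjoint
  have hpu : IsUnit p := (CFC.isUnit_sqrt_iff _ (star_mul_self_nonneg v)).2 (hv.star.mul hv)
  have hpn : ‖p‖ ≤ 2 := by
    have : ‖p‖ * ‖p‖ = ‖v‖ * ‖v‖ := by
      rw [← sq, ← hps.norm_mul_self, hpp, CStarRing.norm_star_mul_self]
    nlinarith [norm_nonneg p, norm_nonneg v]
  obtain ⟨q, hq⟩ := hpu
  have hqs : star (↑q⁻¹ : A) = ↑q⁻¹ := by
    have : star q = q := Units.ext (by simpa [hq] using hps.star_eq)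
    rw [← Units.coe_star_inv, this]
  have hw1 : star (v * ↑q⁻¹) * (v * ↑q⁻¹) = 1 := by
    rw [star_mul, hqs, mul_assoc, ← mul_assoc (star v), ← hpp, ← hq]
    simp
  have hwu : IsUnit (v * ↑q⁻¹) := hv.mul (Units.isUnit _)
  have hw : v * ↑q⁻¹ ∈ unitary A := by
    refine ⟨hw1, ?_⟩
    have : star (v * ↑q⁻¹) = ↑hwu.unit⁻¹ := Units.eq_inv_of_mul_eq_one_right hw1
    rw [this]
    exact hwu.mul_val_inv
  let h : selfAdjoint A := ⟨(2⁻¹ : ℝ) • p, (IsSelfAdjoint.all (2⁻¹ : ℝ)).smul hps⟩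
  have hh : ‖h‖ ≤ 1 := by
    change ‖(2⁻¹ : ℝ) • p‖ ≤ 1
    rw [norm_smul]; norm_num; linarith
  let U := selfAdjoint.unitarySelfAddISMul h hh
  refine ⟨_, mul_mem hw U.2, _, mul_mem hw (star U).2, ?_⟩
  rw [← mul_add, Unitary.coe_star, selfAdjoint.star_coe_unitarySelfAddISMul, selfAdjoint.unitarySelfAddISMul_coe]
  have : (h : A) + h = p := by
    change (2⁻¹ : ℝ) • p + (2⁻¹ : ℝ) • p = p
    rw [← add_smul]; norm_num
  rw [show (h : A) + Complex.I • CFC.sqrt (1 - (h : A) ^ 2) +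
    ((h : A) - Complex.I • CFC.sqrt (1 - (h : A) ^ 2)) = h + h by abel, this, ← hq, mul_assoc]
  simp

theorem exists_unitary_add_eq {a u : A} (ha : ‖a‖ < 1) (hu : u ∈ unitary A) :
    ∃ u₁ ∈ unitary A, ∃ u₂ ∈ unitary A, u + a = u₁ + u₂ := by
  have hn : ‖star u * a‖ < 1 := by
    rwa [CStarRing.norm_mem_unitary_mul _ (Unitary.star_mem hu)]
  have hv : IsUnit (1 + star u * a) := by
    simpa using isUnit_one_sub_of_norm_lt_one (x := -(star u * a)) (by simpa using hn)
  have hv2 : ‖1 + star u * a‖ ≤ 2 := by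
    nontriviality A
    refine (norm_add_le _ _).trans ?_
    rw [CStarRing.norm_one]; linarith
  obtain ⟨u₁, h₁, u₂, h₂, h⟩ := exists_unitary_add_eq_of_isUnit hv hv2
  refine ⟨_, mul_mem hu h₁, _, mul_mem hu h₂, ?_⟩
  rw [← mul_add, ← h, mul_add, ← mul_assoc, hu.2]
  simp

/-- **Russo–Dye**: a bounded operator on a unital C⋆-algebra has its norm determined by the
unitary elements. -/
theorem opNorm_le_of_unitary {E : Type*} [NormedAddCommGroup E] [NormedSpace ℂ E]
    (S : A →L[ℂ] E) {r : ℝ} (hr : ∀ u ∈ unitary A, ‖S u‖ ≤ r) : ‖S‖ ≤ r := by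
  have hr0 : 0 ≤ r := (norm_nonneg _).trans (hr 1 (one_mem _))
  by_contra! hcon
  obtain ⟨a, ha, hra⟩ := S.exists_lt_apply_of_lt_opNorm hcon
  obtain ⟨g, hg, hga⟩ := exists_dual_vector'' ℂ (S a)
  -- With `s = sSup F`, the identity `u + a = u₁ + u₂` gives `Re g(S u) + ‖S a‖ ≤ 2s`. Since `‖S a‖
  -- > s`, this fails for a nearly maximizing `u`.
  let F : Set ℝ := (fun u => (g (S u)).re) '' (unitary A : Set A)
  have hF : ∀ u ∈ unitary A, (g (S u)).re ≤ r := fun u hu =>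
    (Complex.re_le_norm _).trans ((g.le_opNorm _).trans (by nlinarith [hr u hu, norm_nonneg (S u)]))
  have hbdd : BddAbove F := ⟨r, by rintro _ ⟨u, hu, rfl⟩; exact hF u hu⟩
  have hne : F.Nonempty := ⟨_, 1, one_mem (unitary A), rfl⟩
  have hsr : sSup F ≤ r := csSup_le hne (by rintro _ ⟨u, hu, rfl⟩; exact hF u hu)
  have hsa : sSup F < ‖S a‖ := hsr.trans_lt hra
  obtain ⟨_, ⟨u, hu, rfl⟩, hlt⟩ := exists_lt_of_lt_csSup hne
    (show sSup F - (‖S a‖ - sSup F) < sSup F by linarith)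
  obtain ⟨u₁, h₁, u₂, h₂, h⟩ := exists_unitary_add_eq ha hu
  have e := congrArg (fun x => (g (S x)).re) h
  simp only [map_add, Complex.add_re, hga] at e
  have l₁ : (g (S u₁)).re ≤ sSup F := le_csSup hbdd ⟨u₁, h₁, rfl⟩
  have l₂ : (g (S u₂)).re ≤ sSup F := le_csSup hbdd ⟨u₂, h₂, rfl⟩
  simp only [Complex.coe_algebraMap, Complex.ofReal_re] at e
  linarith

end RussoDye

/-! ### Extreme points of dual balls -/

section DualBall

variable {E : Type*} [NormedAddCommGroup E] [NormedSpace ℂ E]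

/-- Needed for the existence of extreme points of weak-* compact sets over the real scalars. -/
instance WeakDual.locallyConvexSpace_real : LocallyConvexSpace ℝ (WeakDual ℂ E) := by
  let L : WeakDual ℂ E →ₗ[ℝ] (E → ℂ) :=
    { toFun := fun f x => f x
      map_add' := fun _ _ => rfl
      map_smul' := fun _ _ => rfl }
  exact LocallyConvexSpace.induced L

/-- The norm of a vector is attained, up to the choice of a phase, at an extreme point of the dual
unit ball. -/
theorem exists_mem_extremePoints_apply_eq_norm (b : E) :
    ∃ f ∈ Set.extremePoints ℝ (Metric.closedBall (0 : StrongDual ℂ E) 1), f b = ‖b‖ := by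
  let B : Set (WeakDual ℂ E) := WeakDual.toStrongDual ⁻¹' Metric.closedBall 0 1
  -- A weak-* compact face of the ball, non-empty by Hahn–Banach; its extreme points are extreme in
  -- the ball.
  let F : Set (WeakDual ℂ E) := {f ∈ B | f b = ‖b‖}
  have hB : IsCompact B := WeakDual.isCompact_closedBall 0 1
  have hF : IsCompact F :=
    hB.inter_right (isClosed_singleton.preimage (WeakDual.eval_continuous b) (t := {(‖b‖ : ℂ)}))
  have hne : F.Nonempty := by
    obtain ⟨g, hg, hgb⟩ := exists_dual_vector'' ℂ b
    exact ⟨StrongDual.toWeakDual g, mem_closedBall_zero_iff.2 hg, hgb⟩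
  have hle : ∀ f ∈ B, (f b).re ≤ ‖b‖ := fun f hf => by
    have h1 : ‖WeakDual.toStrongDual f‖ ≤ 1 := mem_closedBall_zero_iff.1 hf
    have h2 : ‖f b‖ ≤ ‖WeakDual.toStrongDual f‖ * ‖b‖ := (WeakDual.toStrongDual f).le_opNorm b
    exact (Complex.re_le_norm _).trans (h2.trans (by nlinarith [norm_nonneg b]))
  have hnorm : ∀ f ∈ B, (f b).re = ‖b‖ → f b = ‖b‖ := fun f hf hre => by
    have h1 : ‖WeakDual.toStrongDual f‖ ≤ 1 := mem_closedBall_zero_iff.1 hf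
    have h2 : ‖f b‖ ≤ ‖WeakDual.toStrongDual f‖ * ‖b‖ := (WeakDual.toStrongDual f).le_opNorm b
    have h3 : (f b).re = ‖f b‖ := le_antisymm (Complex.re_le_norm _)
      (by rw [hre]; exact h2.trans (by nlinarith [norm_nonneg b]))
    rw [Complex.re_eq_norm] at h3
    rw [← hre]
    exact Complex.ext rfl (by simpa using (Complex.nonneg_iff.1 h3).2.symm)
  have hext : IsExtreme ℝ B F := by
    refine ⟨Set.sep_subset _ _, ?_⟩
    rintro f hf g hg k ⟨hk, hkb⟩ ⟨s, t, hs, ht, hst, rfl⟩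
    refine ⟨hf, hnorm f hf (le_antisymm (hle f hf) ?_)⟩
    have e : s * (f b).re + t * (g b).re = ‖b‖ := by
      have e1 : (s • f + t • g) b = s • f b + t • g b := rfl
      rw [e1] at hkb
      simpa using congrArg Complex.re hkb
    by_contra! hlt
    nlinarith [mul_pos hs (sub_pos.2 hlt), mul_nonneg ht.le (sub_nonneg.2 (hle g hg)),
      congrArg (· * ‖b‖) hst]
  obtain ⟨f, hf⟩ := hF.extremePoints_nonempty hne
  have hfF : f ∈ F := extremePoints_subset hf
  have hfB := hext.extremePoints_subset_extremePoints hf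
  exact ⟨WeakDual.toStrongDual f, hfB, hfF.2⟩

/-- If an extreme point of the unit ball is an `ℓ¹`-decomposable sum, then the summands are its
multiples. -/
theorem eq_norm_smul_of_mem_extremePoints {F : Type*} [NormedAddCommGroup F] [NormedSpace ℝ F]
    {f f₁ f₂ : F} (hf : f ∈ Set.extremePoints ℝ (Metric.closedBall (0 : F) 1))
    (hadd : f₁ + f₂ = f) (hnorm : ‖f₁‖ + ‖f₂‖ ≤ 1) (hf1 : ‖f‖ = 1) : f₁ = ‖f₁‖ • f := by
  have hsum : ‖f₁‖ + ‖f₂‖ = 1 :=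
    le_antisymm hnorm (by rw [← hf1, ← hadd]; exact norm_add_le _ _)
  rcases eq_or_ne f₁ 0 with h1 | h1
  · simp [h1]
  rcases eq_or_ne f₂ 0 with h2 | h2
  · rw [h2, add_zero] at hadd
    rw [hadd, hf1, one_smul]
  have n1 : 0 < ‖f₁‖ := norm_pos_iff.2 h1
  have n2 : 0 < ‖f₂‖ := norm_pos_iff.2 h2
  have hmem : ∀ g : F, g ≠ 0 → ‖g‖⁻¹ • g ∈ Metric.closedBall (0 : F) 1 := fun g hg => by
    rw [mem_closedBall_zero_iff, norm_smul, norm_inv, norm_norm,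
      inv_mul_cancel₀ (norm_ne_zero_iff.2 hg)]
  -- `f` is the convex combination of the normalized summands with weights `‖f₁‖` and `‖f₂‖`.
  have := (mem_extremePoints_iff_left.1 hf).2 _ (hmem f₁ h1) _ (hmem f₂ h2)
    ⟨‖f₁‖, ‖f₂‖, n1, n2, hsum, by
      rw [smul_smul, smul_smul, mul_inv_cancel₀ n1.ne', mul_inv_cancel₀ n2.ne', one_smul,
        one_smul, hadd]⟩
  rw [← this, smul_smul, mul_inv_cancel₀ n1.ne', one_smul]

/-- Nearly norming vectors for `f₁` and `f₂` can be chosen independently and rotated so that both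
values are nonnegative. -/
theorem norm_add_norm_le_of_forall_norm_add_le {f₁ f₂ : StrongDual ℂ E} {r : ℝ}
    (h : ∀ a b : E, ‖a‖ ≤ 1 → ‖b‖ ≤ 1 → ‖f₁ a + f₂ b‖ ≤ r) : ‖f₁‖ + ‖f₂‖ ≤ r := by
  by_contra! hcon
  obtain ⟨a, ha, hfa⟩ := f₁.exists_lt_apply_of_lt_opNorm
    (show ‖f₁‖ - (‖f₁‖ + ‖f₂‖ - r) / 2 < ‖f₁‖ by linarith)
  obtain ⟨b, hb, hfb⟩ := f₂.exists_lt_apply_of_lt_opNorm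
    (show ‖f₂‖ - (‖f₁‖ + ‖f₂‖ - r) / 2 < ‖f₂‖ by linarith)
  obtain ⟨c, hc, hca⟩ := RCLike.exists_norm_eq_mul_self (f₁ a)
  obtain ⟨d, hd, hdb⟩ := RCLike.exists_norm_eq_mul_self (f₂ b)
  have := h (c • a) (d • b) (by rw [norm_smul, hc]; linarith) (by rw [norm_smul, hd]; linarith)
  rw [map_smul, map_smul, smul_eq_mul, smul_eq_mul, ← hca, ← hdb] at this
  have e : ‖((‖f₁ a‖ : ℂ) + (‖f₂ b‖ : ℂ))‖ = ‖f₁ a‖ + ‖f₂ b‖ := by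
    rw [← Complex.ofReal_add, Complex.norm_real, Real.norm_of_nonneg (by positivity)]
  have e' := e.symm.le.trans this
  linarith

end DualBall

/-! ### Commutative C⋆-algebras -/

section Commutative

variable {A : Type*} [CommCStarAlgebra A]

open WeakDual

theorem norm_le_of_forall_characterSpace {a : A} {r : ℝ} (hr : 0 ≤ r)
    (h : ∀ χ : characterSpace ℂ A, ‖χ a‖ ≤ r) : ‖a‖ ≤ r := by
  rw [← (gelfandTransform_isometry A).norm_map_of_map_zero (map_zero _) a]
  exact (ContinuousMap.norm_le _ hr).2 h

theorem norm_character_apply_le (χ : characterSpace ℂ A) (a : A) : ‖χ a‖ ≤ ‖a‖ := by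
  rw [← (gelfandTransform_isometry A).norm_map_of_map_zero (map_zero _) a]
  exact (gelfandTransform ℂ A a).norm_coe_le_norm χ

/-- In a commutative C⋆-algebra, the extreme points of the closed unit ball are unitary. -/
theorem mem_unitary_of_mem_extremePoints {x : A}
    (hx : x ∈ Set.extremePoints ℝ (Metric.closedBall (0 : A) 1)) : x ∈ unitary A := by
  have hx1 : ‖x‖ ≤ 1 := mem_closedBall_zero_iff.1 hx.1
  -- At each character `s + (1 - s²)/2 ≤ 1` for `s = |χ x|`, so `x ± d` stay in the ball and
  -- extremality forces `d = 0`.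
  set d : A := (2⁻¹ : ℂ) • (1 - star x * x) with hd
  have hχ : ∀ χ : characterSpace ℂ A, ‖χ x‖ + ‖χ d‖ ≤ 1 := fun χ => by
    have h1 : ‖χ x‖ ≤ 1 := (norm_character_apply_le χ x).trans hx1
    have h2 : χ d = ((2⁻¹ * (1 - ‖χ x‖ ^ 2) : ℝ) : ℂ) := by
      rw [hd, map_smul, map_sub, map_one, map_mul, map_star]
      simp [RCLike.conj_mul]
    rw [h2, Complex.norm_real, Real.norm_of_nonneg (by nlinarith [norm_nonneg (χ x)])]
    nlinarith [sq_nonneg (1 - ‖χ x‖)]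
  have hp : x + d ∈ Metric.closedBall (0 : A) 1 :=
    mem_closedBall_zero_iff.2 (norm_le_of_forall_characterSpace zero_le_one fun χ => by
      rw [map_add]; exact (norm_add_le _ _).trans (hχ χ))
  have hm : x - d ∈ Metric.closedBall (0 : A) 1 :=
    mem_closedBall_zero_iff.2 (norm_le_of_forall_characterSpace zero_le_one fun χ => by
      rw [map_sub]; exact (norm_sub_le _ _).trans (hχ χ))
  have h := (mem_extremePoints_iff_left.1 hx).2 _ hp _ hm
    ⟨2⁻¹, 2⁻¹, by norm_num, by norm_num, by norm_num, by module⟩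
  have hd0 : d = 0 := by simpa using h
  have h0 : 1 - star x * x = 0 := (smul_eq_zero.1 hd0).resolve_left (by norm_num)
  have h1 : star x * x = 1 := (sub_eq_zero.1 h0).symm
  exact ⟨h1, by rw [mul_comm, h1]⟩

theorem norm_mul_add_one_sub_mul_le {h a b : A} (hh : ∀ χ : characterSpace ℂ A,
    ∃ t : ℝ, 0 ≤ t ∧ t ≤ 1 ∧ χ h = t) (ha : ‖a‖ ≤ 1) (hb : ‖b‖ ≤ 1) :
    ‖h * a + (1 - h) * b‖ ≤ 1 := by
  refine norm_le_of_forall_characterSpace zero_le_one fun χ => ?_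
  obtain ⟨t, ht0, ht1, ht⟩ := hh χ
  have h1 := (norm_character_apply_le χ a).trans ha
  have h2 := (norm_character_apply_le χ b).trans hb
  rw [map_add, map_mul, map_mul, map_sub, map_one, ht]
  refine (norm_add_le _ _).trans ?_
  rw [norm_mul, norm_mul, ← Complex.ofReal_one, ← Complex.ofReal_sub, Complex.norm_real,
    Complex.norm_real, Real.norm_of_nonneg ht0, Real.norm_of_nonneg (sub_nonneg.2 ht1)]
  nlinarith

variable [Nontrivial A] {f : StrongDual ℂ A}

theorem norm_eq_one_of_mem_extremePoints_dual
    (hf : f ∈ Set.extremePoints ℝ (Metric.closedBall (0 : StrongDual ℂ A) 1)) : ‖f‖ = 1 := by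
  obtain ⟨g, hg, -⟩ := exists_dual_vector ℂ (1 : A) (by simp)
  have : Nontrivial (StrongDual ℂ A) := ⟨g, 0, by rintro rfl; simp at hg⟩
  simpa using extremePoints_closedBall_subset_sphere hf

/-- Extreme functionals on a commutative C⋆-algebra are multiplicative up to a scalar:
the self-adjoint case. -/
theorem exists_apply_mul_eq_of_isSelfAdjoint
    (hf : f ∈ Set.extremePoints ℝ (Metric.closedBall (0 : StrongDual ℂ A) 1))
    {b : A} (hb : IsSelfAdjoint b) : ∃ c : ℂ, ∀ a, f (b * a) = c * f a := by
  have hf1 := norm_eq_one_of_mem_extremePoints_dual hf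
  set r : ℝ := ‖b‖ + 1 with hr
  have hr0 : 0 < r := by positivity
  -- An affine rescaling of `b` with values in `[0, 1]` on characters. Then `f = f(h ·) + f((1 - h)
  -- ·)` is an ℓ¹-decomposition, so `f(h ·)` is a multiple of `f`; the scalar for `b = r(2h - 1)`
  -- follows.
  set h : A := (2⁻¹ : ℂ) • (1 + ((r⁻¹ : ℝ) : ℂ) • b) with hh
  have hχ : ∀ χ : characterSpace ℂ A, ∃ t : ℝ, 0 ≤ t ∧ t ≤ 1 ∧ χ h = t := fun χ => by
    have h1 : ‖χ b‖ ≤ r := (norm_character_apply_le χ b).trans (by linarith)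
    have h2 : χ b = ((χ b).re : ℂ) := by
      have : star (χ b) = χ b := by rw [← map_star, hb.star_eq]
      exact (Complex.conj_eq_iff_re.1 this).symm
    have h3 : |(χ b).re| ≤ r := (Complex.abs_re_le_norm _).trans h1
    have h4 : |r⁻¹ * (χ b).re| ≤ 1 := by
      rw [abs_mul, abs_of_pos (inv_pos.2 hr0), inv_mul_le_iff₀ hr0]; linarith
    refine ⟨2⁻¹ * (1 + r⁻¹ * (χ b).re), ?_, ?_, ?_⟩
    · linarith [neg_le_of_abs_le h4]
    · linarith [le_of_abs_le h4]
    · rw [hh, map_smul, map_add, map_one, map_smul, h2]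
      simp
  let f₁ : StrongDual ℂ A := f.comp (ContinuousLinearMap.mul ℂ A h)
  let f₂ : StrongDual ℂ A := f.comp (ContinuousLinearMap.mul ℂ A (1 - h))
  have hadd : f₁ + f₂ = f := by
    ext a
    change f (h * a) + f ((1 - h) * a) = f a
    rw [← map_add]; congr 1; ring
  have hnorm : ‖f₁‖ + ‖f₂‖ ≤ 1 := norm_add_norm_le_of_forall_norm_add_le fun a b ha hb => by
    change ‖f (h * a) + f ((1 - h) * b)‖ ≤ 1
    rw [← map_add]
    refine (f.le_opNorm _).trans ?_
    rw [hf1, one_mul]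
    exact norm_mul_add_one_sub_mul_le hχ ha hb
  have key := eq_norm_smul_of_mem_extremePoints hf hadd hnorm hf1
  refine ⟨r * (2 * ‖f₁‖ - 1), fun a => ?_⟩
  have e1 : f (h * a) = ‖f₁‖ * f a := by
    have e0 : f (h * a) = ‖f₁‖ • f a := DFunLike.congr_fun key a
    rw [e0, Complex.real_smul]
  have e2 : b * a = (r : ℂ) • ((2 : ℂ) • (h * a) - a) := by
    rw [hh, smul_mul_assoc, smul_smul, add_mul, smul_mul_assoc, one_mul,
      show (2 : ℂ) * 2⁻¹ = 1 by norm_num, one_smul, add_sub_cancel_left, smul_smul,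
      ← Complex.ofReal_mul, mul_inv_cancel₀ hr0.ne', Complex.ofReal_one, one_smul]
  rw [e2, map_smul, map_sub, map_smul, e1]
  simp only [smul_eq_mul]
  ring

open ComplexStarModule in
theorem exists_apply_mul_eq
    (hf : f ∈ Set.extremePoints ℝ (Metric.closedBall (0 : StrongDual ℂ A) 1)) (b : A) :
    ∃ c : ℂ, ∀ a, f (b * a) = c * f a := by
  obtain ⟨c, hc⟩ := exists_apply_mul_eq_of_isSelfAdjoint hf (ℜ b).2
  obtain ⟨d, hd⟩ := exists_apply_mul_eq_of_isSelfAdjoint hf (ℑ b).2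
  refine ⟨c + Complex.I * d, fun a => ?_⟩
  conv_lhs => rw [← realPart_add_I_smul_imaginaryPart b]
  rw [add_mul, map_add, smul_mul_assoc, map_smul, hc, hd, smul_eq_mul]
  ring

/-- Extreme points of the dual ball of a commutative C⋆-algebra have modulus one at the unitary
elements. -/
theorem norm_apply_unitary_eq_one
    (hf : f ∈ Set.extremePoints ℝ (Metric.closedBall (0 : StrongDual ℂ A) 1))
    {u : A} (hu : u ∈ unitary A) : ‖f u‖ = 1 := by
  have hf1 := norm_eq_one_of_mem_extremePoints_dual hf
  have hle : ∀ v ∈ unitary A, ∀ c : ℂ, (∀ a, f (v * a) = c * f a) → ‖c‖ ≤ 1 := by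
    intro v hv c hc
    have hfc : ‖c • f‖ ≤ 1 := by
      refine ContinuousLinearMap.opNorm_le_bound _ zero_le_one fun a => ?_
      change ‖c * f a‖ ≤ 1 * ‖a‖
      rw [← hc a]
      refine (f.le_opNorm _).trans ?_
      rw [hf1, CStarRing.norm_mem_unitary_mul _ hv]
    rwa [norm_smul, hf1, mul_one] at hfc
  have hconst : ∀ v ∈ unitary A, ‖f v‖ ≤ ‖f 1‖ := fun v hv => by
    obtain ⟨c, hc⟩ := exists_apply_mul_eq hf v
    have := hc 1
    rw [mul_one] at this
    rw [this, norm_mul]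
    exact mul_le_of_le_one_left (norm_nonneg _) (hle v hv c hc)
  -- By Russo–Dye the bound `‖f 1‖` on unitaries bounds `‖f‖`. Then `f 1 = f(u* u) = c f(u)` with
  -- `‖c‖ ≤ 1` bounds `‖f u‖` below.
  have h1 : 1 ≤ ‖f 1‖ := by rw [← hf1]; exact opNorm_le_of_unitary f hconst
  obtain ⟨c, hc⟩ := exists_apply_mul_eq hf (star u)
  have h2 := hc u
  rw [hu.1] at h2
  have h3 := hle _ (Unitary.star_mem hu) c hc
  refine le_antisymm ?_ ?_
  · refine (f.le_opNorm u).trans ?_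
    rw [hf1, one_mul, CStarRing.norm_of_mem_unitary hu]
  · rw [h2, norm_mul] at h1
    exact h1.trans (mul_le_of_le_one_left (norm_nonneg _) h3)

end Commutative

/-! ### Numerical radius of normal operators -/

section NormalOperator

variable {H : Type*} [NormedAddCommGroup H] [InnerProductSpace ℂ H] [CompleteSpace H]

open ContinuousLinearMap in
/-- Every spectral value of a normal operator is an approximate eigenvalue. -/
theorem exists_norm_apply_sub_smul_lt {b : H →L[ℂ] H} (hb : IsStarNormal b) {k : ℂ}
    (hk : k ∈ spectrum ℂ b) {δ : ℝ} (hδ : 0 < δ) : ∃ ξ : H, ‖ξ‖ = 1 ∧ ‖b ξ - k • ξ‖ < δ := by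
  by_contra! hcon
  set c : H →L[ℂ] H := algebraMap ℂ (H →L[ℂ] H) k - b with hc
  have hcn : IsStarNormal c := by
    refine ⟨?_⟩
    have h1 : Commute (star b) b := hb.star_comm_self
    rw [hc, star_sub, ← algebraMap_star_comm]
    exact (Algebra.commute_algebraMap_left _ _).sub_left
      ((Algebra.commute_algebraMap_right _ _).sub_right h1)
  have hbound : ∀ ξ : H, δ * ‖ξ‖ ≤ ‖c ξ‖ := fun ξ => by
    rcases eq_or_ne ξ 0 with rfl | hξ
    · simp
    have hξ0 : ‖ξ‖ ≠ 0 := norm_ne_zero_iff.2 hξ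
    have hn : ‖((‖ξ‖⁻¹ : ℝ) : ℂ) • ξ‖ = 1 := by
      rw [norm_smul, Complex.norm_real, norm_inv, norm_norm, inv_mul_cancel₀ hξ0]
    have h := hcon _ hn
    have e : b (((‖ξ‖⁻¹ : ℝ) : ℂ) • ξ) - k • (((‖ξ‖⁻¹ : ℝ) : ℂ) • ξ) =
        -(((‖ξ‖⁻¹ : ℝ) : ℂ) • c ξ) := by
      rw [hc, sub_apply, ContinuousLinearMap.algebraMap_apply, map_smul, smul_sub, smul_comm k]
      abel
    rw [e, norm_neg, norm_smul, Complex.norm_real, norm_inv, norm_norm, ← div_eq_inv_mul,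
      le_div_iff₀ (norm_pos_iff.2 hξ)] at h
    exact h
  have hanti : AntilipschitzWith (Real.toNNReal δ⁻¹) c :=
    c.antilipschitz_of_bound fun ξ => by
      rw [Real.coe_toNNReal _ (by positivity), ← div_eq_inv_mul, le_div_iff₀ hδ, mul_comm]
      exact hbound ξ
  have hker : c.ker = ⊥ := by
    rw [LinearMap.ker_eq_bot]
    exact hanti.injective
  -- For normal `c` the orthogonal complement of the range is the kernel, so being bounded below
  -- already gives invertibility.
  have hrange : c.range.topologicalClosure = ⊤ := by
    rw [Submodule.topologicalClosure_eq_top_iff, IsStarNormal.orthogonal_range hcn, hker]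
  exact hk (isUnit_iff_bijective.2 ((bijective_iff_dense_range_and_antilipschitz c).2
    ⟨hrange, _, hanti⟩))

/-- The numerical radius of a normal operator is its norm. -/
theorem exists_norm_inner_apply_gt [Nontrivial H] {b : H →L[ℂ] H} (hb : IsStarNormal b)
    {r : ℝ} (hr : r < ‖b‖) : ∃ ξ : H, ‖ξ‖ = 1 ∧ r < ‖inner ℂ ξ (b ξ)‖ := by
  obtain ⟨k, hk, hkb⟩ := spectrum.exists_nnnorm_eq_spectralRadius b
  rw [hb.spectralRadius_eq_nnnorm b, ENNReal.coe_inj] at hkb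
  have hkn : ‖k‖ = ‖b‖ := congrArg NNReal.toReal hkb
  obtain ⟨ξ, hξ, h⟩ := exists_norm_apply_sub_smul_lt hb hk (sub_pos.2 hr)
  refine ⟨ξ, hξ, ?_⟩
  have e : inner ℂ ξ (b ξ) = inner ℂ ξ (b ξ - k • ξ) + k := by
    rw [inner_sub_right, inner_smul_right, inner_self_eq_norm_sq_to_K, hξ]
    simp
  have h1 : ‖inner ℂ ξ (b ξ - k • ξ)‖ < ‖b‖ - r :=
    (norm_inner_le_norm _ _).trans_lt (by rwa [hξ, one_mul])
  have h2 : ‖k‖ ≤ ‖inner ℂ ξ (b ξ)‖ + ‖inner ℂ ξ (b ξ - k • ξ)‖ := by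
    have : k = inner ℂ ξ (b ξ) - inner ℂ ξ (b ξ - k • ξ) := by rw [e]; ring
    conv_lhs => rw [this]
    exact norm_sub_le _ _
  linarith

end NormalOperator

/-! ### Von Neumann algebras and their preduals -/

namespace VonNeumannAlgebra

variable {H : Type*} [NormedAddCommGroup H] [InnerProductSpace ℂ H] [CompleteSpace H]

theorem isClosed_toStarSubalgebra (X : VonNeumannAlgebra H) :
    IsClosed (X.toStarSubalgebra : Set (H →L[ℂ] H)) := by
  change IsClosed X.carrier
  rw [← X.centralizer_centralizer']
  exact Set.isClosed_centralizer _

attribute [local instance] isClosed_toStarSubalgebra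

instance [Nontrivial H] (X : VonNeumannAlgebra H) : Nontrivial X.toStarSubalgebra :=
  ⟨0, 1, fun h => zero_ne_one (congrArg Subtype.val h)⟩

/-- A vector functional as an element of the predual. -/
noncomputable def vectorPredual (X : VonNeumannAlgebra H) (ξ η : H) : X.Predual :=
  ⟨X.vectorFunctional ξ η, X.vectorFunctional_mem_normalFunctionals ξ η⟩

theorem incl_vectorPredual (X : VonNeumannAlgebra H) (ξ η : H) :
    Predual.incl X (X.vectorPredual ξ η) = X.vectorFunctional ξ η := rfl

theorem norm_vectorPredual_le (X : VonNeumannAlgebra H) (ξ η : H) :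
    ‖X.vectorPredual ξ η‖ ≤ ‖η‖ * ‖ξ‖ := X.norm_vectorFunctional_le ξ η

instance [Nontrivial H] (X : VonNeumannAlgebra H) : Nontrivial X.Predual := by
  obtain ⟨ξ, hξ⟩ := exists_ne (0 : H)
  refine ⟨X.vectorPredual ξ ξ, 0, fun h => hξ ?_⟩
  have h1 := DFunLike.congr_fun (congrArg (Predual.incl X) h) 1
  rw [incl_vectorPredual, vectorFunctional_apply, map_zero] at h1
  exact (inner_self_eq_zero (𝕜 := ℂ)).1 h1

theorem norm_coe_unitary_apply {X : VonNeumannAlgebra H} {u : X.toStarSubalgebra}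
    (hu : u ∈ unitary X.toStarSubalgebra) (ξ : H) : ‖(u : H →L[ℂ] H) ξ‖ = ‖ξ‖ := by
  have h : star (u : H →L[ℂ] H) * u = 1 := congrArg Subtype.val hu.1
  have h1 : inner ℂ ((u : H →L[ℂ] H) ξ) ((u : H →L[ℂ] H) ξ) = inner ℂ ξ ξ := by
    rw [← ContinuousLinearMap.adjoint_inner_right, ← ContinuousLinearMap.star_eq_adjoint]
    exact congrArg (inner ℂ ξ) (DFunLike.congr_fun h ξ)
  rw [inner_self_eq_norm_sq_to_K, inner_self_eq_norm_sq_to_K] at h1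
  have h2 : ‖(u : H →L[ℂ] H) ξ‖ ^ 2 = ‖ξ‖ ^ 2 := by exact_mod_cast h1
  exact (sq_eq_sq₀ (norm_nonneg _) (norm_nonneg _)).1 h2

/-- Unitary elements are extreme points of the unit ball. -/
theorem mem_extremePoints_of_mem_unitary [Nontrivial H] {X : VonNeumannAlgebra H}
    {u : X.toStarSubalgebra} (hu : u ∈ unitary X.toStarSubalgebra) :
    u ∈ Set.extremePoints ℝ (Metric.closedBall (0 : X.toStarSubalgebra) 1) := by
  rw [mem_extremePoints_iff_left]
  refine ⟨mem_closedBall_zero_iff.2 (CStarRing.norm_of_mem_unitary hu).le, ?_⟩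
  rintro a ha b hb ⟨s, t, hs, ht, hst, hab⟩
  have hball : ∀ c ∈ Metric.closedBall (0 : X.toStarSubalgebra) 1, ∀ ξ : H,
      (c : H →L[ℂ] H) ξ ∈ Metric.closedBall (0 : H) ‖ξ‖ := fun c hc ξ => by
    rw [mem_closedBall_zero_iff] at hc ⊢
    exact (c : H →L[ℂ] H).le_of_opNorm_le hc ξ |>.trans_eq (one_mul _)
  ext ξ
  rcases eq_or_ne ξ 0 with rfl | hξ
  · simp
  -- Extremality is tested vector by vector: `u ξ` lies on the sphere of radius `‖ξ‖`, whose points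
  -- are extreme in the ball by strict convexity.
  have : StrictConvexSpace ℝ H := by
    let _ := InnerProductSpace.rclikeToReal ℂ H
    have : UniformConvexSpace H := InnerProductSpace.toUniformConvexSpace
    exact UniformConvexSpace.toStrictConvexSpace
  have hu' : (u : H →L[ℂ] H) ξ ∈ Set.extremePoints ℝ (Metric.closedBall (0 : H) ‖ξ‖) :=
    StrictConvexSpace.sphere_subset_extremePoints_closedBall _ (norm_ne_zero_iff.2 hξ)
      (mem_sphere_zero_iff_norm.2 (norm_coe_unitary_apply hu ξ))
  refine (mem_extremePoints_iff_left.1 hu').2 _ (hball a ha ξ) _ (hball b hb ξ)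
    ⟨s, t, hs, ht, hst, ?_⟩
  rw [← hab]
  rfl

theorem exists_unitary_norm_apply_gt {X : VonNeumannAlgebra H} {E : Type*}
    [NormedAddCommGroup E] [NormedSpace ℂ E] (S : X.toStarSubalgebra →L[ℂ] E) {r : ℝ}
    (hr : r < ‖S‖) : ∃ u ∈ unitary X.toStarSubalgebra, r < ‖S u‖ := by
  by_contra! hcon
  exact absurd (opNorm_le_of_unitary S hcon) (not_le.2 hr)

theorem vectorFunctional_comp_mul (X : VonNeumannAlgebra H) (x : X.toStarSubalgebra) (ξ η : H) :
    (X.vectorFunctional ξ η).comp (ContinuousLinearMap.mul ℂ X.toStarSubalgebra x) =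
      X.vectorFunctional ξ (ContinuousLinearMap.adjoint (x : H →L[ℂ] H) η) :=
  ContinuousLinearMap.ext fun a =>
    (ContinuousLinearMap.adjoint_inner_left (x : H →L[ℂ] H) ((a : H →L[ℂ] H) ξ) η).symm

theorem comp_mul_mem_span (X : VonNeumannAlgebra H) (x : X.toStarSubalgebra)
    {φ : StrongDual ℂ X.toStarSubalgebra} (hφ : φ ∈ Submodule.span ℂ
      {φ : StrongDual ℂ X.toStarSubalgebra | ∃ ξ η : H, φ = X.vectorFunctional ξ η}) :
    φ.comp (ContinuousLinearMap.mul ℂ X.toStarSubalgebra x) ∈ Submodule.span ℂ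
      {φ : StrongDual ℂ X.toStarSubalgebra | ∃ ξ η : H, φ = X.vectorFunctional ξ η} := by
  induction hφ using Submodule.span_induction with
  | mem ψ h =>
    obtain ⟨ξ, η, rfl⟩ := h
    exact Submodule.subset_span ⟨ξ, _, X.vectorFunctional_comp_mul x ξ η⟩
  | zero => rw [ContinuousLinearMap.zero_comp]; exact zero_mem _
  | add a c _ _ ha hc => rw [ContinuousLinearMap.add_comp]; exact add_mem ha hc
  | smul r a _ ha => rw [ContinuousLinearMap.smul_comp]; exact Submodule.smul_mem _ _ ha

theorem comp_mul_mem_normalFunctionals (X : VonNeumannAlgebra H) (x : X.toStarSubalgebra)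
    {φ : StrongDual ℂ X.toStarSubalgebra} (hφ : φ ∈ X.normalFunctionals) :
    (ContinuousLinearMap.compL ℂ X.toStarSubalgebra X.toStarSubalgebra ℂ).flip
      (ContinuousLinearMap.mul ℂ X.toStarSubalgebra x) φ ∈ X.normalFunctionals :=
  map_mem_closure (ContinuousLinearMap.continuous _) hφ fun _ hψ => X.comp_mul_mem_span x hψ

/-- Left multiplication on the predual, `φ ↦ φ (x ·)`. -/
noncomputable def predualMul (X : VonNeumannAlgebra H) (x : X.toStarSubalgebra) :
    X.Predual →L[ℂ] X.Predual :=
  (((ContinuousLinearMap.compL ℂ X.toStarSubalgebra X.toStarSubalgebra ℂ).flip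
    (ContinuousLinearMap.mul ℂ X.toStarSubalgebra x)).comp
      X.normalFunctionals.subtypeL).codRestrict X.normalFunctionals fun φ =>
    X.comp_mul_mem_normalFunctionals x φ.2

theorem incl_predualMul_apply (X : VonNeumannAlgebra H) (x a : X.toStarSubalgebra)
    (φ : X.Predual) : Predual.incl X (X.predualMul x φ) a = Predual.incl X φ (x * a) := rfl

/-- The functional `⟨xξ, · ξ⟩`, multiplied by `x` and evaluated at 1, gives `‖xξ‖²`. -/
theorem norm_le_norm_predualMul (X : VonNeumannAlgebra H) (x : X.toStarSubalgebra) :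
    ‖x‖ ≤ ‖X.predualMul x‖ := by
  refine ContinuousLinearMap.opNorm_le_bound (x : H →L[ℂ] H) (norm_nonneg _) fun ξ => ?_
  set η := (x : H →L[ℂ] H) ξ with hη
  rcases (norm_nonneg η).eq_or_lt with h0 | h0
  · rw [← h0]; positivity
  have h1 : inner ℂ η η = Predual.incl X (X.predualMul x (X.vectorPredual ξ η)) 1 := by
    rw [incl_predualMul_apply, incl_vectorPredual, vectorFunctional_apply, mul_one]
  have hone : ‖(1 : X.toStarSubalgebra)‖ ≤ 1 := ContinuousLinearMap.norm_id_le
  have h2 : ‖η‖ ^ 2 ≤ ‖X.predualMul x‖ * (‖η‖ * ‖ξ‖) := by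
    calc ‖η‖ ^ 2 = ‖inner ℂ η η‖ := by rw [inner_self_eq_norm_sq_to_K]; simp
      _ ≤ ‖Predual.incl X (X.predualMul x (X.vectorPredual ξ η))‖ * ‖(1 : X.toStarSubalgebra)‖ := by
        rw [h1]; exact ContinuousLinearMap.le_opNorm _ _
      _ ≤ ‖X.predualMul x (X.vectorPredual ξ η)‖ := by
        rw [LinearIsometry.norm_map]
        exact mul_le_of_le_one_right (norm_nonneg _) hone
      _ ≤ ‖X.predualMul x‖ * (‖η‖ * ‖ξ‖) :=
        (ContinuousLinearMap.le_opNorm _ _).trans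
          (by gcongr; exact X.norm_vectorPredual_le ξ η)
  refine le_of_mul_le_mul_left ?_ h0
  nlinarith

theorem norm_one_add_smul_predualMul_le (X : VonNeumannAlgebra H) (x : X.toStarSubalgebra)
    (w : ℂ) : ‖1 + w • X.predualMul x‖ ≤ ‖1 + w • x‖ := by
  refine ContinuousLinearMap.opNorm_le_bound _ (norm_nonneg _) fun φ => ?_
  rw [← (Predual.incl X).norm_map, ← (Predual.incl X).norm_map φ]
  refine ContinuousLinearMap.opNorm_le_bound _ (by positivity) fun a => ?_
  have e : Predual.incl X ((1 + w • X.predualMul x) φ) a =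
      Predual.incl X φ ((1 + w • x) * a) := by
    rw [add_mul, one_mul, smul_mul_assoc, map_add, map_smul, ← incl_predualMul_apply]
    simp
  rw [e]
  calc _ ≤ ‖Predual.incl X φ‖ * (‖1 + w • x‖ * ‖a‖) :=
        (ContinuousLinearMap.le_opNorm _ _).trans (by gcongr; exact norm_mul_le _ _)
    _ = _ := by ring

/-- If multiplication by each element of `X` is implemented contractively on a space with numerical
index one, then `X` is commutative. -/
theorem mul_comm_of_numericalIndex_eq_one [Nontrivial H] {X : VonNeumannAlgebra H} {E : Type*}
    [NormedAddCommGroup E] [NormedSpace ℂ E] [Nontrivial E] (hE : numericalIndex ℂ E = 1)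
    (L : X.toStarSubalgebra → E →L[ℂ] E) (hL : ∀ x, ‖x‖ ≤ ‖L x‖)
    (hL' : ∀ x, ∀ w : ℂ, ‖1 + w • L x‖ ≤ ‖1 + w • x‖) (a b : X.toStarSubalgebra) :
    a * b = b * a := by
  refine mul_comm_of_sq_norm_le (fun x => ?_) a b
  refine sq_norm_le_norm_mul_self (x : H →L[ℂ] H) fun ε hε => ?_
  obtain ⟨w, hw, h⟩ := exists_norm_one_add_smul_gt hE (L x) hε
  refine ⟨w, hw, ?_⟩
  have h1 : ‖(x : H →L[ℂ] H)‖ ≤ ‖L x‖ := hL x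
  have h2 : ‖1 + w • L x‖ ≤ ‖1 + w • (x : H →L[ℂ] H)‖ := hL' x w
  linarith

theorem mul_comm_of_numericalIndex_predual [Nontrivial H] {X : VonNeumannAlgebra H}
    (h : numericalIndex ℂ X.Predual = 1) (a b : X.toStarSubalgebra) : a * b = b * a :=
  mul_comm_of_numericalIndex_eq_one h X.predualMul X.norm_le_norm_predualMul
    X.norm_one_add_smul_predualMul_le a b

theorem mul_comm_of_numericalIndex_self [Nontrivial H] {X : VonNeumannAlgebra H}
    (h : numericalIndex ℂ X.toStarSubalgebra = 1) (a b : X.toStarSubalgebra) : a * b = b * a := by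
  refine mul_comm_of_numericalIndex_eq_one h
    (fun x => ContinuousLinearMap.mul ℂ X.toStarSubalgebra x) (fun x => ?_) (fun x w => ?_) a b
  · have h1 := (ContinuousLinearMap.mul ℂ X.toStarSubalgebra x).le_opNorm 1
    rwa [ContinuousLinearMap.mul_apply', mul_one, CStarRing.norm_one, mul_one] at h1
  · refine ContinuousLinearMap.opNorm_le_bound _ (norm_nonneg _) fun a => ?_
    have e : (1 + w • ContinuousLinearMap.mul ℂ X.toStarSubalgebra x) a = (1 + w • x) * a := by
      rw [add_mul, one_mul, smul_mul_assoc]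
      rfl
    rw [e]
    exact norm_mul_le _ _

/-! ### Numerical index and extreme points in von Neumann algebras -/

section Commutative

variable {X : VonNeumannAlgebra H}

theorem vectorFunctional_unitary_apply {u : X.toStarSubalgebra}
    (hu : u ∈ unitary X.toStarSubalgebra) {ξ : H} (hξ : ‖ξ‖ = 1) :
    X.vectorFunctional ξ ((u : H →L[ℂ] H) ξ) u = 1 := by
  rw [vectorFunctional_apply, inner_self_eq_norm_sq_to_K, norm_coe_unitary_apply hu, hξ]
  simp

variable [Nontrivial H]

/-- In a commutative von Neumann algebra, every element is almost normed by a normal functional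
which is normed by a prescribed unitary element. -/
theorem exists_norm_inner_unitary_gt (hX : ∀ a b : X.toStarSubalgebra, a * b = b * a)
    {u : X.toStarSubalgebra} (hu : u ∈ unitary X.toStarSubalgebra) (b : X.toStarSubalgebra)
    {r : ℝ} (hr : r < ‖b‖) :
    ∃ ξ : H, ‖ξ‖ = 1 ∧ r < ‖X.vectorFunctional ξ ((u : H →L[ℂ] H) ξ) b‖ := by
  have hn : IsStarNormal ((star u * b : X.toStarSubalgebra) : H →L[ℂ] H) :=
    ⟨congrArg Subtype.val (hX (star (star u * b)) (star u * b))⟩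
  have hr' : r < ‖((star u * b : X.toStarSubalgebra) : H →L[ℂ] H)‖ := by
    change r < ‖star u * b‖
    rwa [CStarRing.norm_mem_unitary_mul _ (Unitary.star_mem hu)]
  obtain ⟨ξ, hξ, h⟩ := exists_norm_inner_apply_gt hn hr'
  refine ⟨ξ, hξ, ?_⟩
  rw [vectorFunctional_apply, ← ContinuousLinearMap.adjoint_inner_right,
    ← ContinuousLinearMap.star_eq_adjoint]
  exact h

theorem norm_vectorFunctional_unitary {u : X.toStarSubalgebra}
    (hu : u ∈ unitary X.toStarSubalgebra) {ξ : H} (hξ : ‖ξ‖ = 1) :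
    ‖X.vectorFunctional ξ ((u : H →L[ℂ] H) ξ)‖ = 1 := by
  refine le_antisymm ?_ ?_
  · refine (X.norm_vectorFunctional_le _ _).trans_eq ?_
    rw [norm_coe_unitary_apply hu, hξ, one_mul]
  · have h := (X.vectorFunctional ξ ((u : H →L[ℂ] H) ξ)).le_opNorm u
    rwa [vectorFunctional_unitary_apply hu hξ, norm_one, CStarRing.norm_of_mem_unitary hu,
      mul_one] at h

theorem numericalIndex_predual_eq_one (hX : ∀ a b : X.toStarSubalgebra, a * b = b * a) :
    numericalIndex ℂ X.Predual = 1 := by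
  refine numericalIndex_eq_one_iff.2 fun T => le_of_forall_lt fun r hr => ?_
  -- The adjoint of `T`, with `X` acting on `X_*` by evaluation: `S a φ = (T φ)(a)`.
  let S : X.toStarSubalgebra →L[ℂ] StrongDual ℂ X.Predual :=
    ((Predual.incl X).toContinuousLinearMap.comp T).flip
  have hS : ‖S‖ = ‖T‖ := by
    rw [ContinuousLinearMap.opNorm_flip]
    exact (Predual.incl X).norm_toContinuousLinearMap_comp
  obtain ⟨u, hu, hur⟩ := exists_unitary_norm_apply_gt S (hS.symm ▸ hr)
  obtain ⟨b, ⟨hb, hφ⟩, -⟩ := X.existsUnique_dual_predual (S u)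
  obtain ⟨ξ, hξ, h⟩ := exists_norm_inner_unitary_gt hX hu b (hb.symm ▸ hur)
  let F : StrongDual ℂ X.Predual := (Predual.incl X).toContinuousLinearMap.flip u
  let φ : X.Predual := X.vectorPredual ξ ((u : H →L[ℂ] H) ξ)
  have hφ1 : ‖φ‖ = 1 := norm_vectorFunctional_unitary hu hξ
  have hFφ : F φ = 1 := vectorFunctional_unitary_apply hu hξ
  have hF : ‖F‖ = 1 := by
    refine le_antisymm ?_ ?_
    · refine ContinuousLinearMap.opNorm_le_bound _ zero_le_one fun ψ => ?_
      have h1 := (Predual.incl X ψ).le_opNorm u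
      rw [CStarRing.norm_of_mem_unitary hu, LinearIsometry.norm_map, mul_one] at h1
      exact h1.trans_eq (one_mul _).symm
    · have h1 := F.le_opNorm φ
      rwa [hFφ, hφ1, norm_one, mul_one] at h1
  refine h.trans_le ((le_of_eq ?_).trans (le_numericalRadius T hφ1 hF hFφ))
  exact congrArg norm (hφ φ).symm

/-- Over a commutative von Neumann algebra, extreme functionals have modulus one at the extreme
points of the unit ball. -/
theorem norm_extremePoint_apply_extremePoint (hX : ∀ a b : X.toStarSubalgebra, a * b = b * a)
    {f : StrongDual ℂ X.toStarSubalgebra}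
    (hf : f ∈ Set.extremePoints ℝ (Metric.closedBall (0 : StrongDual ℂ X.toStarSubalgebra) 1))
    {x : X.toStarSubalgebra}
    (hx : x ∈ Set.extremePoints ℝ (Metric.closedBall (0 : X.toStarSubalgebra) 1)) :
    ‖f x‖ = 1 := by
  let _ : CommCStarAlgebra X.toStarSubalgebra :=
    { (inferInstance : CStarAlgebra X.toStarSubalgebra) with mul_comm := hX }
  exact norm_apply_unitary_eq_one hf (mem_unitary_of_mem_extremePoints hx)

theorem numericalIndex_eq_one_of_extremePoints
    (h : ∀ f ∈ Set.extremePoints ℝ (Metric.closedBall (0 : StrongDual ℂ X.toStarSubalgebra) 1),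
      ∀ x ∈ Set.extremePoints ℝ (Metric.closedBall (0 : X.toStarSubalgebra) 1), ‖f x‖ = 1) :
    numericalIndex ℂ X.toStarSubalgebra = 1 := by
  refine numericalIndex_eq_one_iff.2 fun T => le_of_forall_lt fun r hr => ?_
  obtain ⟨u, hu, hur⟩ := exists_unitary_norm_apply_gt T hr
  obtain ⟨f, hf, hfT⟩ := exists_mem_extremePoints_apply_eq_norm (T u)
  have hfu := h f hf u (mem_extremePoints_of_mem_unitary hu)
  have hu1 := CStarRing.norm_of_mem_unitary hu
  -- Rotating `f` makes its value at `u` equal to 1 and does not change `|f (T u)|`.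
  obtain ⟨c, hc, hcf⟩ := RCLike.exists_norm_eq_mul_self (f u)
  have hcu : (c • f) u = 1 := by
    change c * f u = 1
    rw [← hcf, hfu]
    simp
  have hcn : ‖c • f‖ = 1 := by
    refine le_antisymm ?_ ?_
    · rw [norm_smul, hc, one_mul]
      exact mem_closedBall_zero_iff.1 hf.1
    · have h1 := (c • f).le_opNorm u
      rwa [hcu, norm_one, hu1, mul_one] at h1
  refine hur.trans_le ((le_of_eq ?_).trans (le_numericalRadius T hu1 hcn hcu))
  change ‖T u‖ = ‖c * f (T u)‖
  rw [norm_mul, hc, hfT, one_mul, Complex.norm_real, norm_norm]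

end Commutative

end VonNeumannAlgebra

theorem mainTheorem7 {H : Type*} [NormedAddCommGroup H] [InnerProductSpace ℂ H] [CompleteSpace H]
    [Nontrivial H] (X : VonNeumannAlgebra H) :
    List.TFAE [
      numericalIndex ℂ X.toStarSubalgebra = 1,
      ∀ f ∈ Set.extremePoints ℝ (Metric.closedBall (0 : StrongDual ℂ X.toStarSubalgebra) 1),
        ∀ x ∈ Set.extremePoints ℝ (Metric.closedBall (0 : X.toStarSubalgebra) 1), ‖f x‖ = 1,
      numericalIndex ℂ X.Predual = 1] := by
  tfae_have 1 → 3 := fun h =>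
    VonNeumannAlgebra.numericalIndex_predual_eq_one
      (VonNeumannAlgebra.mul_comm_of_numericalIndex_self h)
  tfae_have 3 → 2 := fun h _ hf _ hx =>
    VonNeumannAlgebra.norm_extremePoint_apply_extremePoint
      (VonNeumannAlgebra.mul_comm_of_numericalIndex_predual h) hf hx
  tfae_have 2 → 1 := VonNeumannAlgebra.numericalIndex_eq_one_of_extremePoints
  tfae_finish
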